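/- **Game.** Let $n\ge 1$ and $\varepsilon>0$. In the variable-processor cup game with resource augmentation $\varepsilon$ there are $n$ cups with fills $x_1,\dots,x_n$, all initially $0$. In each round the filler, who is adaptive, chooses an integer $1\le p\le n$ and reals $a_1,\dots,a_n\in[0,1]$ with $\sum_i a_i=p$, and replaces every $x_i$ by $x_i'=x_i+a_i$; then the emptier chooses a set $S\subseteq\{1,\dots,n\}$ with $|S|=p$, replaces $x_i'$ by $\max(0,x_i'-(1+\varepsilon))$ for each $i\in S$, and leaves the other cups unchanged. The backlog is $\max_i x_i$. The greedy emptying algorithm always takes $S$ to be a set of $p$ fullest cups (with respect to the fills $x_i'$), with ties broken in any way. **Theorem.** For $\varepsilon\in[\omega(1/n),1]$ the greedy emptying algorithm achieves backlog $O(\varepsilon^{-1}\log n)$, in games of any length. That is, there is an absolute constant $C>0$ such that for every function $\delta:\mathbb N\to\mathbb R$ with $n\,\delta(n)\to\infty$, all sufficiently large $n$ (depending on $\delta$), and every $\varepsilon$ with $\delta(n)\le\varepsilon\le 1$, the following holds in the variable-processor cup game on $n$ cups with resource augmentation $\varepsilon$: if the emptier is greedy, then against every adaptive filler and for every $t\ge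 0$, the backlog after $t$ rounds is at most $C\,\varepsilon^{-1}\log n$. -/

import Mathlib

namespace CupGame

/-- A state of the game: the fills of the `n` cups. -/
abbrev State (n : ℕ) : Type := Fin n → ℝ

/-- A legal move of the filler in one round: an integer `1 ≤ p ≤ n` and amounts
`a i ∈ [0, 1]` with total exactly `p`. -/
structure FillerMove (n : ℕ) where
  p : ℕ
  one_le_p : 1 ≤ p
  p_le : p ≤ n
  a : Fin n → ℝ
  a_nonneg : ∀ i, 0 ≤ a i
  a_le_one : ∀ i, a i ≤ 1
  sum_a : ∑ i, a i = (p : ℝ)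

/-- The fills after the filler has moved, before the emptier moves. -/
def fill {n : ℕ} (x : State n) (m : FillerMove n) : State n := fun i => x i + m.a i

/-- The emptier, with resource augmentation `ε`, removes up to `1 + ε` units of water
from every cup in `S`; no fill drops below `0`. -/
noncomputable def empty {n : ℕ} (ε : ℝ) (y : State n) (S : Finset (Fin n)) : State n :=
  fun i => if i ∈ S then max 0 (y i - (1 + ε)) else y i

/-- The backlog of a state: the largest fill. -/
noncomputable def backlog {n : ℕ} (x : State n) : ℝ := ⨆ i, x i

/-- A record of the finished rounds (the filler's move and the set of cups chosen by the
emptier), the most recent round first. -/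
abbrev History (n : ℕ) : Type := List (FillerMove n × Finset (Fin n))

/-- The state after the rounds recorded in a history; all cups are empty at the start. -/
noncomputable def stateAfter {n : ℕ} (ε : ℝ) : History n → State n
  | [] => fun _ => 0
  | (m, S) :: h => empty ε (fill (stateAfter ε h) m) S

/-- A strategy of the adaptive filler: the next move as a function of everything that has
happened so far. -/
abbrev Filler (n : ℕ) : Type := History n → FillerMove n

/-- A strategy of the adaptive emptier: given the past rounds and the filler's move in the
current round, it chooses a set of exactly `p` cups to empty from. -/
structure Emptier (n : ℕ) where
  select : History n → FillerMove n → Finset (Fin n)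
  card_select : ∀ h m, (select h m).card = m.p

/-- The emptier plays the greedy algorithm: it always empties from the `p` fullest cups (the
fills being those after the filler's move); ties may be broken in any way. -/
def Emptier.IsGreedy {n : ℕ} (E : Emptier n) (ε : ℝ) : Prop :=
  ∀ (h : History n) (m : FillerMove n), ∀ i ∈ E.select h m, ∀ j ∉ E.select h m,
    fill (stateAfter ε h) m j ≤ fill (stateAfter ε h) m i

/-- The first `t` rounds of the game played by the filler `F` against the emptier `E`. -/
def play {n : ℕ} (F : Filler n) (E : Emptier n) : ℕ → History n
  | 0 => []
  | t + 1 => (F (play F E t), E.select (play F E t) (F (play F E t))) :: play F E t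

/-- In the game on `n` cups with resource augmentation `ε`, the emptier `E` achieves backlog
at most `B`: no adaptive filler exceeds `B` after any number of rounds. -/
def Emptier.AchievesBacklog {n : ℕ} (E : Emptier n) (ε B : ℝ) : Prop :=
  ∀ (F : Filler n) (t : ℕ), backlog (stateAfter ε (play F E t)) ≤ B

end CupGame

namespace CupGame

open Finset

/-! The potential `∑ exp (ε x_i / 4)` never exceeds `7n/ε`. Let `T` be the total weight of the
greedy set after filling. Filling adds at most `(ε/4) T`, since greedy picks the heaviest cups;
emptying removes a fraction larger than `ε/4` of `T`, except for losses at cups that hit the floor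
`0`. These losses matter only if some chosen cup is nearly empty, and then every unchosen cup is low
too (`potential_empty_fill_le`). One cup's weight is at most the potential, so taking logarithms
bounds its fill. -/

/-- Over weights `a i ∈ [0, 1]` whose total is `S.card`, the weighted sum of `w` is largest on a
set `S` of largest values. -/
lemma sum_mul_le_sum_of_top {ι : Type*} [Fintype ι] [DecidableEq ι] {S : Finset ι}
    (hS : S.Nonempty) (w a : ι → ℝ) (ha0 : ∀ i, 0 ≤ a i) (ha1 : ∀ i, a i ≤ 1)
    (hsum : ∑ i, a i = S.card) (hw : ∀ i ∈ S, ∀ j ∉ S, w j ≤ w i) :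
    ∑ i, a i * w i ≤ ∑ i ∈ S, w i := by
  obtain ⟨k, hk, hmin⟩ := S.exists_min_image w hS
  have key : ∀ i, a i * (w i - w k) ≤ if i ∈ S then w i - w k else 0 := by
    intro i
    split_ifs with hi
    · exact mul_le_of_le_one_left (sub_nonneg.2 (hmin i hi)) (ha1 i)
    · exact mul_nonpos_of_nonneg_of_nonpos (ha0 i) (sub_nonpos.2 (hw k hk i hi))
  have h := Finset.sum_le_sum fun i (_ : i ∈ univ) => key i
  simp only [mul_sub, sum_sub_distrib, ← sum_mul, hsum, sum_ite_mem, univ_inter, sum_const,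
    nsmul_eq_mul] at h
  linarith

/-- The exponential potential of a state. -/
noncomputable def potential {n : ℕ} (l : ℝ) (x : State n) : ℝ := ∑ i, Real.exp (l * x i)

lemma stateAfter_nonneg {n : ℕ} {ε : ℝ} (h : History n) (i : Fin n) :
    0 ≤ stateAfter ε h i := by
  induction h with
  | nil => simp [stateAfter]
  | cons r h ih =>
    obtain ⟨m, S⟩ := r
    simp only [stateAfter, empty, fill]
    split_ifs
    · exact le_max_left _ _
    · exact add_nonneg ih (m.a_nonneg i)

/-- The tangent bound `1 - z ≤ exp (-z)` is applied at the filled level, so the increase is measured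
in the weights by which greedy chooses. -/
lemma potential_fill_le {n : ℕ} {l : ℝ} (x : State n) (m : FillerMove n) :
    potential l (fill x m) ≤
      potential l x + l * ∑ i, m.a i * Real.exp (l * fill x m i) := by
  rw [potential, potential, mul_sum, ← sum_add_distrib]
  refine sum_le_sum fun i _ => ?_
  have h1 : Real.exp (l * x i) = Real.exp (l * fill x m i) * Real.exp (-(l * m.a i)) := by
    rw [← Real.exp_add, fill]
    ring_nf
  have h2 := Real.add_one_le_exp (-(l * m.a i))
  rw [h1]
  nlinarith [mul_le_mul_of_nonneg_left h2 (Real.exp_pos (l * fill x m i)).le]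

/-- The relative decrease of the potential of an emptied cup lies between
`ε / 4 + ε ^ 2 / 8` and `ε / 2`. -/
lemma one_sub_exp_bounds {ε : ℝ} (h0 : 0 < ε) (h1 : ε ≤ 1) :
    ε / 4 + ε ^ 2 / 8 ≤ 1 - Real.exp (-(ε / 4 * (1 + ε))) ∧
      1 - Real.exp (-(ε / 4 * (1 + ε))) ≤ ε / 2 := by
  have hu0 : 0 < ε / 4 * (1 + ε) := by positivity
  have hu2 : ε / 4 * (1 + ε) ≤ ε / 2 := by nlinarith
  refine ⟨?_, ?_⟩
  · have hq := Real.quadratic_le_exp_of_nonneg hu0.le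
    set u := ε / 4 * (1 + ε) with hu
    have hpos : 0 < 1 + u + u ^ 2 / 2 := by positivity
    have hinv : Real.exp (-u) ≤ 1 - u + u ^ 2 / 2 := by
      rw [Real.exp_neg]
      calc (Real.exp u)⁻¹ ≤ (1 + u + u ^ 2 / 2)⁻¹ := inv_anti₀ hpos hq
        _ ≤ 1 - u + u ^ 2 / 2 := by
          rw [inv_le_iff_one_le_mul₀ hpos]
          nlinarith [sq_nonneg (u ^ 2)]
    have : u ^ 2 ≤ (ε / 2) ^ 2 := pow_le_pow_left₀ hu0.le hu2 2
    nlinarith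
  · linarith [Real.add_one_le_exp (-(ε / 4 * (1 + ε)))]

/-- One greedy round preserves the bound `7 n / ε` on the potential. -/
lemma potential_empty_fill_le {n : ℕ} {ε : ℝ} (h0 : 0 < ε) (h1 : ε ≤ 1) (x : State n)
    (hx : ∀ i, 0 ≤ x i) (m : FillerMove n) (S : Finset (Fin n)) (hcard : S.card = m.p)
    (hS : ∀ i ∈ S, ∀ j ∉ S, fill x m j ≤ fill x m i)
    (hpot : potential (ε / 4) x ≤ 7 * n / ε) :
    potential (ε / 4) (empty ε (fill x m) S) ≤ 7 * n / ε := by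
  obtain ⟨hb1, hb2⟩ := one_sub_exp_bounds h0 h1
  set b := 1 - Real.exp (-(ε / 4 * (1 + ε))) with hb
  set y := fill x m with hy
  set w : Fin n → ℝ := fun i => Real.exp (ε / 4 * y i) with hw
  have hy0 : ∀ i, 0 ≤ y i := fun i => add_nonneg (hx i) (m.a_nonneg i)
  have hb0 : 0 ≤ b := by nlinarith
  have hw1 : ∀ i, 1 ≤ w i := fun i => Real.one_le_exp (by have := hy0 i; positivity)
  have hSne : S.Nonempty := card_pos.1 (hcard ▸ m.one_le_p)
  have hdec : ∀ i, Real.exp (ε / 4 * (y i - (1 + ε))) = (1 - b) * w i := fun i => by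
    rw [hb, sub_sub_cancel, hw, ← Real.exp_add]
    congr 1
    ring
  have htop : ∑ i, m.a i * w i ≤ ∑ i ∈ S, w i :=
    sum_mul_le_sum_of_top hSne w m.a m.a_nonneg m.a_le_one (by rw [m.sum_a, hcard])
      fun i hi j hj => Real.exp_le_exp.2 (mul_le_mul_of_nonneg_left (hS i hi j hj) (by positivity))
  have hfill : ∑ i, w i ≤ potential (ε / 4) x + ε / 4 * ∑ i ∈ S, w i :=
    (potential_fill_le x m).trans (by gcongr)
  have hT0 : 0 ≤ ∑ i ∈ S, w i := sum_nonneg fun i _ => (zero_le_one.trans (hw1 i))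
  by_cases hc : ∃ k ∈ S, y k < 1 + ε
  · obtain ⟨k, hk, hyk⟩ := hc
    rcases le_total (4 * n / ε) (∑ i ∈ S, w i) with hT | hT
    -- The floor costs at most `b` per cup: `1 ≤ (1 - b) w + b` as `w ≥ 1`. The total `n b ≤ n ε /
    -- 2` is paid by the surplus `(ε ^ 2 / 8) T`, as `T ≥ 4n/ε`.
    · have hterm : ∀ i, Real.exp (ε / 4 * empty ε y S i) ≤
          w i - (if i ∈ S then b * w i else 0) + b := by
        intro i
        unfold empty
        split_ifs with hi
        · rcases max_cases 0 (y i - (1 + ε)) with ⟨h, -⟩ | ⟨h, -⟩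
          · rw [h, mul_zero, Real.exp_zero]
            nlinarith [hw1 i, Real.exp_pos (-(ε / 4 * (1 + ε)))]
          · rw [h, hdec]
            linarith
        · simp only [hw]
          linarith
      have h := sum_le_sum fun i (_ : i ∈ univ) => hterm i
      simp only [sum_add_distrib, sum_sub_distrib, sum_ite_mem, univ_inter, ← mul_sum, sum_const,
        card_univ, Fintype.card_fin, nsmul_eq_mul] at h
      rw [div_le_iff₀ h0] at hT
      have h3 : (ε / 4 + ε ^ 2 / 8) * ∑ i ∈ S, w i ≤ b * ∑ i ∈ S, w i := by gcongr
      have h4 : (n : ℝ) * b ≤ n * (ε / 2) := by gcongr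
      have h5 : ε * (4 * n) ≤ ε * ((∑ i ∈ S, w i) * ε) := by gcongr
      refine le_trans h ?_
      nlinarith
    -- Unchosen cups have fill at most `2`, hence weight below `3`; no decrease is needed here.
    · have hterm : ∀ i, Real.exp (ε / 4 * empty ε y S i) ≤ (if i ∈ S then w i else 0) + 3 := by
        intro i
        unfold empty
        split_ifs with hi
        · have : Real.exp (ε / 4 * max 0 (y i - (1 + ε))) ≤ w i :=
            Real.exp_le_exp.2 (mul_le_mul_of_nonneg_left
              (max_le (hy0 i) (by linarith)) (by positivity))
          linarith
        · have h2 : y i ≤ 2 := by linarith [hS k hk i hi]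
          have : Real.exp (ε / 4 * y i) ≤ Real.exp 1 :=
            Real.exp_le_exp.2 (by nlinarith)
          linarith [Real.exp_one_lt_d9]
      have h := sum_le_sum fun i (_ : i ∈ univ) => hterm i
      simp only [sum_add_distrib, sum_ite_mem, univ_inter, sum_const,
        card_univ, Fintype.card_fin, nsmul_eq_mul] at h
      have h3 : (n : ℝ) * 3 ≤ 3 * n / ε := by
        rw [le_div_iff₀ h0]
        nlinarith [(Nat.cast_nonneg n : (0 : ℝ) ≤ n)]
      calc _ ≤ _ := h
        _ ≤ 4 * n / ε + 3 * n / ε := add_le_add hT h3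
        _ = 7 * n / ε := by ring
  · push Not at hc
    have hterm : ∀ i, Real.exp (ε / 4 * empty ε y S i) = w i - (if i ∈ S then b * w i else 0) := by
      intro i
      unfold empty
      split_ifs with hi
      · rw [max_eq_right (sub_nonneg.2 (hc i hi)), hdec]
        ring
      · simp [hw]
    rw [potential, sum_congr rfl fun i _ => hterm i]
    simp only [sum_sub_distrib, sum_ite_mem, univ_inter, ← mul_sum]
    have h3 : ε / 4 * ∑ i ∈ S, w i ≤ b * ∑ i ∈ S, w i := by
      gcongr
      nlinarith
    linarith

lemma potential_play_le {n : ℕ} {ε : ℝ} (h0 : 0 < ε) (h1 : ε ≤ 1) (E : Emptier n)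
    (hE : E.IsGreedy ε) (F : Filler n) (t : ℕ) :
    potential (ε / 4) (stateAfter ε (play F E t)) ≤ 7 * n / ε := by
  induction t with
  | zero =>
    simp only [play, stateAfter, potential, mul_zero, Real.exp_zero, sum_const, card_univ,
      Fintype.card_fin, nsmul_eq_mul, mul_one]
    rw [le_div_iff₀ h0]
    nlinarith [(Nat.cast_nonneg n : (0 : ℝ) ≤ n)]
  | succ t ih =>
    exact potential_empty_fill_le h0 h1 _ (stateAfter_nonneg _) _ _ (E.card_select _ _)
      (hE _ _) ih

end CupGame

theorem mainTheorem4 :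
    ∃ C : ℝ, 0 < C ∧
      ∀ δ : ℕ → ℝ, Filter.Tendsto (fun n : ℕ => (n : ℝ) * δ n) Filter.atTop Filter.atTop →
        ∀ᶠ n : ℕ in Filter.atTop, ∀ ε : ℝ, δ n ≤ ε → ε ≤ 1 →
          ∀ E : CupGame.Emptier n, E.IsGreedy ε →
            E.AchievesBacklog ε (C * (ε⁻¹ * Real.log n)) := by
  refine ⟨12, by norm_num, fun δ hδ => ?_⟩
  -- `n ε ≥ 1` and `n ≥ 7` give `7n/ε ≤ n ^ 3`; the exponent `3` over the rate `ε / 4` yields `12`.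
  filter_upwards [hδ.eventually_ge_atTop 1, Filter.eventually_ge_atTop 7]
    with n hn hn7 ε hε h1 E hE F t
  have hn7' : (7 : ℝ) ≤ n := by exact_mod_cast hn7
  have hnε : 1 ≤ n * ε := hn.trans (by gcongr)
  have h0 : 0 < ε := pos_of_mul_pos_right (zero_lt_one.trans_le hnε) (by positivity)
  have : Nonempty (Fin n) := ⟨⟨0, by omega⟩⟩
  refine ciSup_le fun i => ?_
  have hexp : Real.exp (ε / 4 * CupGame.stateAfter ε (CupGame.play F E t) i) ≤ (n : ℝ) ^ 3 :=
    calc _ ≤ CupGame.potential (ε / 4) (CupGame.stateAfter ε (CupGame.play F E t)) :=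
          Finset.single_le_sum (f := fun i => Real.exp (ε / 4 *
            CupGame.stateAfter ε (CupGame.play F E t) i))
            (fun _ _ => (Real.exp_pos _).le) (Finset.mem_univ i)
      _ ≤ 7 * n / ε := CupGame.potential_play_le h0 h1 E hE F t
      _ ≤ n ^ 3 := by
          rw [div_le_iff₀ h0]
          calc (7 : ℝ) * n ≤ n * n * 1 := by nlinarith
            _ ≤ n * n * (n * ε) := by gcongr
            _ = n ^ 3 * ε := by ring
  have hlog := (Real.le_log_iff_exp_le (by positivity)).2 hexp
  rw [Real.log_pow] at hlog
  push_cast at hlog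
  have : 12 * (ε⁻¹ * Real.log n) = 12 * Real.log n / ε := by ring
  rw [this, le_div_iff₀ h0]
  linarith
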